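/- Let $(X,d)$ be a finite nonempty metric space with $n$ points and let $\mathbb F$ be a field. For $r\ge 0$ let $\mathrm{VR}_r(X)$ be the simplicial complex on the vertex set $X$ whose faces are the finite subsets $\sigma\subseteq X$ of diameter at most $r$. For an integer $k$ let $\mathrm{PH}^{\mathrm{VR}}_k(X)$ be the persistence module $r\mapsto \widetilde H_k(\mathrm{VR}_r(X);\mathbb F)$, $r\ge 0$ (reduced simplicial homology), with the linear maps induced by the inclusions $\mathrm{VR}_r(X)\subseteq \mathrm{VR}_s(X)$ for $r\le s$. For real numbers $b<d$ let $I[b,d)$ be the interval module over the scales $r\ge 0$ that is $\mathbb F$ for $b\le r<d$ and $0$ for all other $r$, with identity maps between the copies of $\mathbb F$ and zero maps otherwise. If $n\ge 2$, then for $x\in X$ let $t_d(x)\ge t_b(x)$ be the two largest distances from $x$ to points of $X$, counted with multiplicity; that is, choose distinct $x_1,x_2\in X$ with $d(x,x_1)\ge d(x,x_2)\ge d(x,a)$ for all $a\in X\setminus\{x_1,x_2\}$ and put $t_d(x)=d(x,x_1)$, $t_b(x)=d(x,x_2)$. Define $$t_b(X)=\max_{x\in X}t_b(x),\qquad t_d(X)=\min_{x\in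 X}t_d(x).$$ Then: 1. For all integers $k>\frac n2-1$, $\mathrm{PH}^{\mathrm{VR}}_k(X)=0$. 2. If $n$ is even and $k=\frac n2-1$, then $\mathrm{PH}^{\mathrm{VR}}_k(X)$ is isomorphic to a single interval module $I[t_b(X),t_d(X))$ with $t_b(X)<t_d(X)$ if and only if $t_b(X)<t_d(X)$, and otherwise $\mathrm{PH}^{\mathrm{VR}}_k(X)=0$. -/

import Mathlib

open CategoryTheory CategoryTheory.Limits
open scoped NNReal

/-! ### Reduced simplicial homology -/

namespace VR

universe u v

/-- The quotient `Z / (B ∩ Z)` of two submodules of `M`; it is `Z / B` if `B ≤ Z`. -/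
abbrev Subquotient {R : Type u} {M : Type v} [Ring R] [AddCommGroup M] [Module R M]
    (Z B : Submodule R M) : Type v :=
  Z ⧸ B.submoduleOf Z

/-- The map `Z / B → Z' / B'`, `[z] ↦ [z]`, for `Z ≤ Z'` and `B ≤ B'`. -/
def Subquotient.map {R : Type u} {M : Type v} [Ring R] [AddCommGroup M] [Module R M]
    {Z Z' B B' : Submodule R M} (hZ : Z ≤ Z') (hB : B ≤ B') :
    Subquotient Z B →ₗ[R] Subquotient Z' B' :=
  Submodule.mapQ _ _ (Submodule.inclusion hZ) (fun _ h => hB h)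

/-- An auxiliary total order on the vertices. It is only used to orient the simplices. -/
noncomputable abbrev vertexOrder (V : Type v) : LinearOrder V :=
  @linearOrderOfSTO V WellOrderingRel _ (Classical.decRel _)

/-- The sign of the facet `σ \ {v}` in the boundary of `σ`: it is `(-1) ^ i` where `v` is the
`i`-th vertex of `σ` in increasing order, starting from `i = 0`. -/
def facetSign (F : Type u) [Field F] {V : Type v} [LinearOrder V] (σ : Finset V) (v : V) : F :=
  (-1) ^ (σ.filter (fun w => w < v)).card

/-- The simplicial boundary operator on formal linear combinations of finite vertex sets,
`∂ [v₀ < ⋯ < vₖ] = ∑ i, (-1) ^ i [v₀, …, v̂ᵢ, …, vₖ]`. In particular `∂ [v] = [∅]` for a vertex `v`,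
which is the augmentation map of reduced homology, and `∂ [∅] = 0`. -/
noncomputable def boundary (F : Type u) [Field F] (V : Type v) [LinearOrder V] :
    (Finset V →₀ F) →ₗ[F] (Finset V →₀ F) :=
  Finsupp.linearCombination F
    (fun σ : Finset V => ∑ v ∈ σ, Finsupp.single (σ.erase v) (facetSign F σ v))

theorem boundary_single (F : Type u) [Field F] {V : Type v} [LinearOrder V] (σ : Finset V) :
    boundary F V (Finsupp.single σ 1) =
      ∑ v ∈ σ, Finsupp.single (σ.erase v) (facetSign F σ v) := by
  simp [boundary]

theorem facetSign_mul (F : Type u) [Field F] {V : Type v} [LinearOrder V] (σ : Finset V)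
    {v w : V} (hv : v ∈ σ) (hvw : v < w) :
    facetSign F σ v * facetSign F (σ.erase v) w + facetSign F σ w * facetSign F (σ.erase w) v
      = 0 := by
  have h1 : (σ.erase w).filter (fun x => x < v) = σ.filter (fun x => x < v) := by
    ext x
    simp only [Finset.mem_filter, Finset.mem_erase]
    constructor
    · rintro ⟨⟨_, h⟩, h'⟩
      exact ⟨h, h'⟩
    · rintro ⟨h, h'⟩
      exact ⟨⟨(h'.trans hvw).ne, h⟩, h'⟩
  have h2 : (σ.filter (fun x => x < w)).card
      = ((σ.erase v).filter (fun x => x < w)).card + 1 := by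
    rw [Finset.filter_erase, Finset.card_erase_add_one]
    simp [hv, hvw]
  simp only [facetSign, h1, h2]
  ring

/-- The boundary of a boundary is zero. -/
theorem boundary_boundary (F : Type u) [Field F] {V : Type v} [LinearOrder V]
    (c : Finset V →₀ F) : boundary F V (boundary F V c) = 0 := by
  suffices h : boundary F V ∘ₗ boundary F V = 0 from LinearMap.congr_fun h c
  refine Finsupp.lhom_ext' fun σ => LinearMap.ext_ring ?_
  have hs : ∀ (τ : Finset V) (a : F), boundary F V (Finsupp.single τ a) =
      ∑ w ∈ τ, Finsupp.single (τ.erase w) (a * facetSign F τ w) := by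
    intro τ a
    simp [boundary, Finset.smul_sum]
  simp only [LinearMap.coe_comp, Function.comp_apply, Finsupp.lsingle_apply, map_sum, hs, LinearMap.zero_apply]
  rw [Finset.sum_sigma']
  refine Finset.sum_involution (fun p _ => ⟨p.2, p.1⟩) ?_ ?_ ?_ ?_
  · rintro ⟨v, w⟩ h
    simp only [Finset.mem_sigma, Finset.mem_erase] at h
    obtain ⟨hv, hne, hw⟩ := h
    simp only
    rw [Finset.erase_right_comm (a := w) (b := v), ← Finsupp.single_add, one_mul, one_mul]
    rcases lt_or_gt_of_ne hne with h | h
    · rw [add_comm (facetSign F σ v * _), facetSign_mul F σ hw h, Finsupp.single_zero]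
    · rw [facetSign_mul F σ hv h, Finsupp.single_zero]
  · rintro ⟨v, w⟩ h _ he
    simp only [Finset.mem_sigma, Finset.mem_erase] at h
    simp only [Sigma.mk.injEq] at he
    exact h.2.1 he.1
  · rintro ⟨v, w⟩ h
    simp only [Finset.mem_sigma, Finset.mem_erase] at h ⊢
    exact ⟨h.2.2, h.2.1.symm, h.1⟩
  · rintro ⟨v, w⟩ _
    rfl

/-- The `k`-chains of the augmented chain complex of `K`: linear combinations of the faces with
`k + 1` vertices, where the empty face is counted as the unique face of dimension `-1`. -/
noncomputable def chains (F : Type u) [Field F] {V : Type v} (K : AbstractSimplicialComplex V)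
    (k : ℤ) : Submodule F (Finset V →₀ F) :=
  Finsupp.supported F F {σ : Finset V | (σ = ∅ ∨ σ ∈ K) ∧ (σ.card : ℤ) = k + 1}

/-- The `k`-cycles of the augmented chain complex. -/
noncomputable def cycles (F : Type u) [Field F] {V : Type v} [LinearOrder V]
    (K : AbstractSimplicialComplex V) (k : ℤ) : Submodule F (Finset V →₀ F) :=
  chains F K k ⊓ LinearMap.ker (boundary F V)

/-- The `k`-boundaries of the augmented chain complex. -/
noncomputable def boundaries (F : Type u) [Field F] {V : Type v} [LinearOrder V]
    (K : AbstractSimplicialComplex V) (k : ℤ) : Submodule F (Finset V →₀ F) :=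
  (chains F K (k + 1)).map (boundary F V)

theorem boundary_mem_chains (F : Type u) [Field F] {V : Type v} [LinearOrder V]
    (K : AbstractSimplicialComplex V) (k : ℤ) {c : Finset V →₀ F} (hc : c ∈ chains F K (k + 1)) :
    boundary F V c ∈ chains F K k := by
  rw [boundary, Finsupp.linearCombination_apply]
  refine Submodule.sum_mem _ fun σ hσ => Submodule.smul_mem _ _ (Submodule.sum_mem _ fun v hv => ?_)
  obtain ⟨h, hcard⟩ := (Finsupp.mem_supported F c).1 hc hσ
  refine Finsupp.single_mem_supported F _ ⟨?_, ?_⟩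
  · rcases (σ.erase v).eq_empty_or_nonempty with h0 | h0
    · exact Or.inl h0
    · rcases h with rfl | h
      · simp at hv
      · exact Or.inr ((K.isRelLowerSet_faces h).2 (Finset.erase_subset v σ) h0)
  · have := Finset.card_erase_add_one hv
    omega

/-- Boundaries are cycles. -/
theorem boundaries_le_cycles (F : Type u) [Field F] {V : Type v} [LinearOrder V]
    (K : AbstractSimplicialComplex V) (k : ℤ) : boundaries F K k ≤ cycles F K k := by
  rintro _ ⟨c, hc, rfl⟩
  exact ⟨boundary_mem_chains F K k hc, boundary_boundary F c⟩

theorem chains_mono (F : Type u) [Field F] {V : Type v}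
    {K L : AbstractSimplicialComplex V} (h : K ≤ L) (k : ℤ) : chains F K k ≤ chains F L k :=
  Finsupp.supported_mono fun _ hσ => ⟨hσ.1.imp_right fun hK => h hK, hσ.2⟩

theorem cycles_mono (F : Type u) [Field F] {V : Type v} [LinearOrder V]
    {K L : AbstractSimplicialComplex V} (h : K ≤ L) (k : ℤ) : cycles F K k ≤ cycles F L k :=
  inf_le_inf_right _ (chains_mono F h k)

theorem boundaries_mono (F : Type u) [Field F] {V : Type v} [LinearOrder V]
    {K L : AbstractSimplicialComplex V} (h : K ≤ L) (k : ℤ) :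
    boundaries F K k ≤ boundaries F L k :=
  Submodule.map_mono (chains_mono F h (k + 1))

/-- The reduced simplicial homology `H̃ₖ(K; F)`: cycles modulo boundaries of the augmented chain
complex. -/
abbrev ReducedHomology (F : Type u) [Field F] {V : Type v} [LinearOrder V]
    (K : AbstractSimplicialComplex V) (k : ℤ) : Type (max u v) :=
  Subquotient (cycles F K k) (boundaries F K k)

/-- The map in reduced homology induced by an inclusion of simplicial complexes. -/
noncomputable def ReducedHomology.map (F : Type u) [Field F] {V : Type v} [LinearOrder V]
    {K L : AbstractSimplicialComplex V} (h : K ≤ L) (k : ℤ) :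
    ReducedHomology F K k →ₗ[F] ReducedHomology F L k :=
  Subquotient.map (cycles_mono F h k) (boundaries_mono F h k)

/-! ### The Vietoris-Rips complex and its persistent homology -/

/-- The Vietoris-Rips complex of `X` at scale `r`: its faces are the nonempty finite subsets of
diameter at most `r`. -/
def vrComplex (X : Type v) [MetricSpace X] (r : ℝ≥0) : AbstractSimplicialComplex X where
  faces := {σ : Finset X | σ.Nonempty ∧ Metric.diam (σ : Set X) ≤ r}
  isRelLowerSet_faces := fun _ hσ => ⟨hσ.1, fun _ hτσ hτ =>
    ⟨hτ, (Metric.diam_mono (Finset.coe_subset.2 hτσ) (Finset.finite_toSet _).isBounded).trans hσ.2⟩⟩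
  singleton_mem := fun x => ⟨Finset.singleton_nonempty x, by simp⟩

theorem vrComplex_mono (X : Type v) [MetricSpace X] {r s : ℝ≥0} (h : r ≤ s) :
    vrComplex X r ≤ vrComplex X s :=
  fun _ hσ => ⟨hσ.1, hσ.2.trans (NNReal.coe_le_coe.2 h)⟩

/-- The persistence module `r ↦ H̃ₖ(VR_r(X); F)`, `r ≥ 0`, with the maps induced by inclusions,
computed with the simplices oriented by a given total order of `X`. -/
noncomputable def orderedPersistentHomology (F : Type u) [Field F] (X : Type v) [MetricSpace X]
    [LinearOrder X] (k : ℤ) : ℝ≥0 ⥤ ModuleCat.{max u v} F where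
  obj r := ModuleCat.of F (ReducedHomology F (vrComplex X r) k)
  map f := ModuleCat.ofHom (ReducedHomology.map F (vrComplex_mono X (leOfHom f)) k)
  map_id r := by
    refine ModuleCat.hom_ext (LinearMap.ext fun x => ?_)
    obtain ⟨z, rfl⟩ := Submodule.Quotient.mk_surjective _ x
    rfl
  map_comp f g := by
    refine ModuleCat.hom_ext (LinearMap.ext fun x => ?_)
    obtain ⟨z, rfl⟩ := Submodule.Quotient.mk_surjective _ x
    rfl

/-- The reduced Vietoris-Rips persistent homology of `X` in degree `k`, as a functor from the
poset of scales `r ≥ 0` to vector spaces over `F`. -/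
noncomputable def persistentHomology (F : Type u) [Field F] (X : Type v) [MetricSpace X]
    (k : ℤ) : ℝ≥0 ⥤ ModuleCat.{max u v} F :=
  @orderedPersistentHomology F _ X _ (vertexOrder X) k

/-! ### Interval modules -/

open Classical in
/-- The value of the interval module `I[b, d)` at `r`: the whole line `F` if `b ≤ r < d`, and `0`
otherwise. -/
noncomputable def intervalValue (F : Type u) [Field F] (b d : ℝ) (r : ℝ≥0) : Submodule F F :=
  if b ≤ r ∧ r < d then ⊤ else ⊥

open Classical in
/-- The structure map of the interval module `I[b, d)` from `r` to `s`: the identity of `F` if both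
`r` and `s` lie in `[b, d)`, and `0` otherwise. -/
noncomputable def intervalMap (F : Type u) [Field F] (b d : ℝ) (r s : ℝ≥0) :
    intervalValue F b d r →ₗ[F] intervalValue F b d s :=
  if h : (b ≤ r ∧ r < d) ∧ (b ≤ s ∧ s < d) then
    Submodule.inclusion (by simp [intervalValue, h])
  else 0

theorem intervalMap_self (F : Type u) [Field F] (b d : ℝ) (r : ℝ≥0) :
    intervalMap F b d r r = LinearMap.id := by
  by_cases h : b ≤ r ∧ r < d
  · rw [intervalMap, dif_pos ⟨h, h⟩]
    rfl
  · have : Subsingleton (intervalValue F b d r) := by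
      rw [intervalValue, if_neg h]
      infer_instance
    exact Subsingleton.elim _ _

theorem intervalMap_comp (F : Type u) [Field F] (b d : ℝ) {r s t : ℝ≥0} (hrs : r ≤ s)
    (hst : s ≤ t) :
    intervalMap F b d s t ∘ₗ intervalMap F b d r s = intervalMap F b d r t := by
  by_cases hr : b ≤ r ∧ r < d
  · by_cases ht : b ≤ t ∧ t < d
    · have hs : b ≤ s ∧ s < d :=
        ⟨hr.1.trans (NNReal.coe_le_coe.2 hrs), lt_of_le_of_lt (NNReal.coe_le_coe.2 hst) ht.2⟩
      rw [intervalMap, intervalMap, intervalMap, dif_pos ⟨hs, ht⟩, dif_pos ⟨hr, hs⟩,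
        dif_pos ⟨hr, ht⟩]
      rfl
    · have h1 : intervalMap F b d s t = 0 := dif_neg (fun h => ht h.2)
      have h2 : intervalMap F b d r t = 0 := dif_neg (fun h => ht h.2)
      rw [h1, h2, LinearMap.zero_comp]
  · have h1 : intervalMap F b d r s = 0 := dif_neg (fun h => hr h.1)
    have h2 : intervalMap F b d r t = 0 := dif_neg (fun h => hr h.1)
    rw [h1, h2, LinearMap.comp_zero]

/-- The interval module `I[b, d)` over the scales `r ≥ 0`. The universe lift has no mathematical
content. -/
noncomputable def intervalModule (F : Type u) [Field F] (b d : ℝ) :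
    ℝ≥0 ⥤ ModuleCat.{max u v} F where
  obj r := ModuleCat.of F (ULift.{v} (intervalValue F b d r))
  map {r s} _ := ModuleCat.ofHom
    (ULift.moduleEquiv.symm.toLinearMap ∘ₗ intervalMap F b d r s ∘ₗ ULift.moduleEquiv.toLinearMap)
  map_id r := by
    refine ModuleCat.hom_ext (LinearMap.ext fun x => ?_)
    simp [intervalMap_self]
  map_comp {r s t} f g := by
    refine ModuleCat.hom_ext (LinearMap.ext fun x => ?_)
    simp [← intervalMap_comp F b d (leOfHom f) (leOfHom g)]

/-- The persistence module `M` is the single interval module `I[b, d)`, where `b < d`. -/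
def IsInterval {F : Type u} [Field F] (M : ℝ≥0 ⥤ ModuleCat.{max u v} F) (b d : ℝ) : Prop :=
  b < d ∧ Nonempty (M ≅ intervalModule.{u, v} F b d)

/-! ### The two largest distances -/

/-- `x₁` and `x₂` are (distinct) points of `X` at the largest and at the second largest distance
from `x`, in this order, where distances are counted with multiplicity. -/
def IsTwoFarthest {X : Type v} [MetricSpace X] (x x₁ x₂ : X) : Prop :=
  x₁ ≠ x₂ ∧ dist x x₂ ≤ dist x x₁ ∧ ∀ a : X, a ≠ x₁ → a ≠ x₂ → dist x a ≤ dist x x₂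

theorem exists_isTwoFarthest {X : Type v} [MetricSpace X] [Finite X] [Nontrivial X] (x : X) :
    ∃ p : X × X, IsTwoFarthest x p.1 p.2 := by
  obtain ⟨x₁, h₁⟩ := Finite.exists_max (fun a : X => dist x a)
  obtain ⟨y, hy⟩ := exists_ne x₁
  have : Nonempty {a : X // a ≠ x₁} := ⟨⟨y, hy⟩⟩
  obtain ⟨x₂, h₂⟩ := Finite.exists_max (fun a : {a : X // a ≠ x₁} => dist x a)
  exact ⟨(x₁, x₂), x₂.2.symm, h₁ _, fun a ha _ => h₂ ⟨a, ha⟩⟩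

open Classical in
/-- A choice of two farthest points from `x`; the default value `(x, x)` only occurs if `X` has
one point or is infinite. -/
noncomputable def twoFarthest {X : Type v} [MetricSpace X] (x : X) : X × X :=
  if h : ∃ p : X × X, IsTwoFarthest x p.1 p.2 then h.choose else (x, x)

/-- `t_d(x)`, the largest distance from `x` to a point of `X`. -/
noncomputable def pointDeath {X : Type v} [MetricSpace X] (x : X) : ℝ := dist x (twoFarthest x).1

/-- `t_b(x)`, the second largest distance from `x` to a point of `X`, with multiplicity. -/
noncomputable def pointBirth {X : Type v} [MetricSpace X] (x : X) : ℝ := dist x (twoFarthest x).2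

theorem twoFarthest_spec {X : Type v} [MetricSpace X] [Finite X] [Nontrivial X] (x : X) :
    IsTwoFarthest x (twoFarthest x).1 (twoFarthest x).2 := by
  rw [twoFarthest, dif_pos (exists_isTwoFarthest x)]
  exact (exists_isTwoFarthest x).choose_spec

/-- The two largest distances do not depend on the choice of the two farthest points. -/
theorem IsTwoFarthest.dist_eq {X : Type v} [MetricSpace X] {x x₁ x₂ : X}
    (h : IsTwoFarthest x x₁ x₂) : pointDeath x = dist x x₁ ∧ pointBirth x = dist x x₂ := by
  have hex : ∃ p : X × X, IsTwoFarthest x p.1 p.2 := ⟨(x₁, x₂), h⟩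
  have hs : IsTwoFarthest x (twoFarthest x).1 (twoFarthest x).2 := by
    rw [twoFarthest, dif_pos hex]
    exact hex.choose_spec
  rw [pointDeath, pointBirth]
  generalize (twoFarthest x).1 = y₁ at *
  generalize (twoFarthest x).2 = y₂ at *
  obtain ⟨hne, hle, hmax⟩ := h
  obtain ⟨hne', hle', hmax'⟩ := hs
  have a1 := hmax y₁
  have a2 := hmax y₂
  have b1 := hmax' x₁
  have b2 := hmax' x₂
  by_cases e1 : y₁ = x₁
  · subst e1
    by_cases e2 : y₂ = x₂
    · subst e2
      exact ⟨rfl, rfl⟩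
    · exact ⟨rfl, le_antisymm (a2 hne'.symm e2) (b2 hne.symm (Ne.symm e2))⟩
  · by_cases e2 : y₁ = x₂
    · subst e2
      by_cases e3 : y₂ = x₁
      · subst e3
        exact ⟨le_antisymm hle hle', le_antisymm hle' hle⟩
      · have := a2 e3 hne'.symm
        have := b1 hne (Ne.symm e3)
        constructor <;> linarith
    · have c1 := a1 e1 e2
      by_cases e3 : y₂ = x₁
      · subst e3
        have := b2 (Ne.symm e2) hne.symm
        constructor <;> linarith
      · have c2 := b1 (Ne.symm e1) (Ne.symm e3)
        by_cases e4 : y₂ = x₂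
        · subst e4
          constructor <;> linarith
        · have := a2 e3 e4
          have := b2 (Ne.symm e2) (Ne.symm e4)
          constructor <;> linarith

/-- `t_b(X) = max_x t_b(x)`. -/
noncomputable def birth (X : Type v) [MetricSpace X] : ℝ := ⨆ x : X, pointBirth x

/-- `t_d(X) = min_x t_d(x)`. -/
noncomputable def death (X : Type v) [MetricSpace X] : ℝ := ⨅ x : X, pointDeath x

end VR

/-! The complex at scale `r` is the clique complex of the graph joining points at distance at most
`r`. Faces are counted by their number of vertices `m = k + 1`, so the claim is that a clique
complex on fewer than `2 * m` vertices has no homology on `m`-vertex faces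
(`CliqueAcyclic.of_card_lt`). A vertex adjacent to all others makes the complex a cone. Otherwise
delete a vertex `v`: a cycle is a boundary once the link of `v` is acyclic one dimension lower and
the deletion is acyclic (`CliqueAcyclic.of_link`). The link misses `v` and a non-neighbour, so the
bound survives and induction applies.

On exactly `2 * m` vertices the same argument works unless every vertex has exactly one
non-neighbour, i.e. the complex is the boundary of a cross-polytope. That is an iterated suspension
of the empty complex, so its homology is a line spanned by an explicit cycle. The graph has this
form exactly when `birth X ≤ r < death X`, and it is constant over these scales, so one cycle
generates the whole interval. -/

namespace VR

universe u v

/-! ### Exterior algebra: multiplication by and contraction with a vertex. -/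

section Operators

theorem linearMap_ext_single {F : Type u} [Field F] {V : Type v}
    {f g : (Finset V →₀ F) →ₗ[F] (Finset V →₀ F)}
    (h : ∀ σ, f (Finsupp.single σ 1) = g (Finsupp.single σ 1)) : f = g :=
  Finsupp.lhom_ext' fun σ => LinearMap.ext_ring (h σ)

variable {F : Type u} [Field F] {V : Type v} [LinearOrder V]

/-- Left multiplication by the vertex `v`: the signed cone operator `σ ↦ ± (σ ∪ {v})`. -/
noncomputable def coneMap (F : Type u) [Field F] {V : Type v} [LinearOrder V] (v : V) :
    (Finset V →₀ F) →ₗ[F] (Finset V →₀ F) :=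
  Finsupp.linearCombination F
    (fun σ : Finset V => if v ∈ σ then 0 else Finsupp.single (insert v σ) (facetSign F σ v))

/-- Contraction with the vertex `v`: the signed operator `σ ↦ ± (σ \ {v})` on simplices
containing `v`, and zero on the others. -/
noncomputable def linkMap (F : Type u) [Field F] {V : Type v} [LinearOrder V] (v : V) :
    (Finset V →₀ F) →ₗ[F] (Finset V →₀ F) :=
  Finsupp.linearCombination F
    (fun σ : Finset V => if v ∈ σ then Finsupp.single (σ.erase v) (facetSign F σ v) else 0)

theorem boundary_single' (σ : Finset V) (a : F) :
    boundary F V (Finsupp.single σ a) =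
      ∑ w ∈ σ, Finsupp.single (σ.erase w) (a * facetSign F σ w) := by
  simp [boundary, Finset.smul_sum]

theorem coneMap_single_of_mem {v : V} {σ : Finset V} (h : v ∈ σ) (a : F) :
    coneMap F v (Finsupp.single σ a) = 0 := by
  simp [coneMap, h]

theorem coneMap_single_of_notMem {v : V} {σ : Finset V} (h : v ∉ σ) (a : F) :
    coneMap F v (Finsupp.single σ a) =
      Finsupp.single (insert v σ) (a * facetSign F σ v) := by
  simp [coneMap, h]

theorem linkMap_single_of_mem {v : V} {σ : Finset V} (h : v ∈ σ) (a : F) :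
    linkMap F v (Finsupp.single σ a) =
      Finsupp.single (σ.erase v) (a * facetSign F σ v) := by
  simp [linkMap, h]

theorem linkMap_single_of_notMem {v : V} {σ : Finset V} (h : v ∉ σ) (a : F) :
    linkMap F v (Finsupp.single σ a) = 0 := by
  simp [linkMap, h]

theorem facetSign_mul_self (σ : Finset V) (v : V) :
    facetSign F σ v * facetSign F σ v = 1 := by
  rw [facetSign, ← mul_pow]
  simp

theorem facetSign_insert_self (σ : Finset V) (v : V) :
    facetSign F (insert v σ) v = facetSign F σ v := by
  simp [facetSign, Finset.filter_insert]

theorem facetSign_erase_self (σ : Finset V) (v : V) :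
    facetSign F (σ.erase v) v = facetSign F σ v := by
  simp [facetSign, Finset.filter_erase]

theorem facetSign_mul_of_ne (σ : Finset V) {v w : V} (hv : v ∈ σ) (hw : w ∈ σ) (hvw : v ≠ w) :
    facetSign F σ v * facetSign F (σ.erase v) w =
      -(facetSign F σ w * facetSign F (σ.erase w) v) := by
  rcases lt_or_gt_of_ne hvw with h | h
  · exact eq_neg_of_add_eq_zero_left (facetSign_mul F σ hv h)
  · exact eq_neg_of_add_eq_zero_right (facetSign_mul F σ hw h)

/-- The cone operator is a contracting homotopy of the full simplex. -/
theorem boundary_coneMap_add (v : V) (c : Finset V →₀ F) :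
    boundary F V (coneMap F v c) + coneMap F v (boundary F V c) = c := by
  suffices h : boundary F V ∘ₗ coneMap F v + coneMap F v ∘ₗ boundary F V = LinearMap.id from
    LinearMap.congr_fun h c
  refine linearMap_ext_single fun σ => ?_
  simp only [LinearMap.add_apply, LinearMap.comp_apply, LinearMap.id_apply]
  by_cases hv : v ∈ σ
  · rw [coneMap_single_of_mem hv, map_zero, zero_add, boundary_single', map_sum,
      Finset.sum_eq_single_of_mem v hv]
    · rw [coneMap_single_of_notMem (Finset.notMem_erase v σ), Finset.insert_erase hv,
        facetSign_erase_self, one_mul, facetSign_mul_self]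
    · intro w _ hw
      exact coneMap_single_of_mem (Finset.mem_erase.2 ⟨hw.symm, hv⟩) _
  · rw [coneMap_single_of_notMem hv, boundary_single', boundary_single', map_sum,
      Finset.sum_insert hv, Finset.erase_insert hv, facetSign_insert_self, one_mul,
      facetSign_mul_self, add_assoc, ← Finset.sum_add_distrib, Finset.sum_eq_zero, add_zero]
    intro w hw
    have hne : w ≠ v := fun h => hv (h ▸ hw)
    rw [coneMap_single_of_notMem (fun h => hv (Finset.mem_of_mem_erase h)),
      Finset.erase_insert_of_ne hne.symm, ← Finsupp.single_add]
    have h := facetSign_mul_of_ne (F := F) (insert v σ) (Finset.mem_insert_self v σ)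
      (Finset.mem_insert_of_mem hw) hne.symm
    rw [Finset.erase_insert hv, Finset.erase_insert_of_ne hne.symm, facetSign_insert_self,
      facetSign_insert_self] at h
    have h2 := facetSign_mul_self (F := F) σ v
    have h3 := facetSign_mul_self (F := F) (insert v σ) w
    have : facetSign F σ v * facetSign F (insert v σ) w +
        1 * facetSign F σ w * facetSign F (σ.erase w) v = 0 := by
      -- Multiply `h` by both signs of `w`, in `insert v σ` and in `σ`, and cancel squares of signs.
      linear_combination (-(facetSign F σ w) * facetSign F (σ.erase w) v) * h3 +
        (facetSign F (insert v σ) w * facetSign F σ w) * h -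
        (facetSign F σ v * facetSign F (insert v σ) w) *
          (facetSign_mul_self (F := F) σ w)
    rw [this, Finsupp.single_zero]

/-- The boundary is the sum of the contractions with all vertices, and contractions anticommute. -/
theorem boundary_linkMap (v : V) (c : Finset V →₀ F) :
    boundary F V (linkMap F v c) = -linkMap F v (boundary F V c) := by
  suffices h : boundary F V ∘ₗ linkMap F v = -(linkMap F v ∘ₗ boundary F V) from
    LinearMap.congr_fun h c
  refine linearMap_ext_single fun σ => ?_
  simp only [LinearMap.neg_apply, LinearMap.comp_apply]
  by_cases hv : v ∈ σ
  · rw [linkMap_single_of_mem hv, boundary_single', boundary_single', map_sum,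
      ← Finset.add_sum_erase σ _ hv, linkMap_single_of_notMem (Finset.notMem_erase v σ),
      zero_add, ← Finset.sum_neg_distrib]
    refine Finset.sum_congr rfl fun w hw => ?_
    obtain ⟨hne, hw⟩ := Finset.mem_erase.1 hw
    rw [linkMap_single_of_mem (Finset.mem_erase.2 ⟨hne.symm, hv⟩),
      Finset.erase_right_comm, ← Finsupp.single_neg, one_mul, one_mul,
      facetSign_mul_of_ne σ hv hw hne.symm]
  · rw [linkMap_single_of_notMem hv, map_zero, boundary_single', map_sum, Finset.sum_eq_zero,
      neg_zero]
    intro w _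
    exact linkMap_single_of_notMem (fun h => hv (Finset.mem_of_mem_erase h)) _

/-- The two summands are the projections onto the simplices containing `v` and onto those avoiding
`v`. -/
theorem coneMap_linkMap_add (v : V) (c : Finset V →₀ F) :
    coneMap F v (linkMap F v c) + linkMap F v (coneMap F v c) = c := by
  suffices h : coneMap F v ∘ₗ linkMap F v + linkMap F v ∘ₗ coneMap F v = LinearMap.id from
    LinearMap.congr_fun h c
  refine linearMap_ext_single fun σ => ?_
  simp only [LinearMap.add_apply, LinearMap.comp_apply, LinearMap.id_apply]
  by_cases hv : v ∈ σ
  · rw [coneMap_single_of_mem hv, map_zero, add_zero, linkMap_single_of_mem hv,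
      coneMap_single_of_notMem (Finset.notMem_erase v σ), Finset.insert_erase hv,
      facetSign_erase_self, one_mul, facetSign_mul_self]
  · rw [linkMap_single_of_notMem hv, map_zero, zero_add, coneMap_single_of_notMem hv,
      linkMap_single_of_mem (Finset.mem_insert_self v σ), Finset.erase_insert hv,
      facetSign_insert_self, one_mul, facetSign_mul_self]

end Operators

/-! ### Homology of clique complexes with few vertices. -/

section Clique

variable {F : Type u} [Field F] {V : Type v} {G : SimpleGraph V}

/-- The chains of the clique complex of `G` restricted to the vertex set `S`, spanned by the
simplices with `m` vertices. -/
noncomputable def cliqueChains (F : Type u) [Field F] {V : Type v} (G : SimpleGraph V)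
    (S : Finset V) (m : ℕ) : Submodule F (Finset V →₀ F) :=
  Finsupp.supported F F {σ : Finset V | G.IsNClique m σ ∧ σ ⊆ S}

theorem cliqueChains_mono {S T : Finset V} (h : S ⊆ T) (m : ℕ) :
    cliqueChains F G S m ≤ cliqueChains F G T m :=
  Finsupp.supported_mono fun _ hσ => ⟨hσ.1, hσ.2.trans h⟩

theorem map_mem_cliqueChains {S T : Finset V} {m n : ℕ}
    (f : (Finset V →₀ F) →ₗ[F] (Finset V →₀ F))
    (h : ∀ σ, G.IsNClique m σ → σ ⊆ S → ∀ a, f (Finsupp.single σ a) ∈ cliqueChains F G T n)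
    {c : Finset V →₀ F} (hc : c ∈ cliqueChains F G S m) : f c ∈ cliqueChains F G T n := by
  rw [← Finsupp.sum_single c, Finsupp.sum, map_sum]
  refine Submodule.sum_mem _ fun σ hσ => ?_
  obtain ⟨h1, h2⟩ := (Finsupp.mem_supported F c).1 hc hσ
  exact h σ h1 h2 _

theorem eq_zero_of_mem_cliqueChains_empty {m : ℕ} {c : Finset V →₀ F}
    (hc : c ∈ cliqueChains F G ∅ (m + 1)) : c = 0 := by
  have h : {σ : Finset V | G.IsNClique (m + 1) σ ∧ σ ⊆ ∅} = ∅ := by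
    refine Set.eq_empty_of_forall_notMem fun σ hσ => ?_
    obtain rfl := Finset.subset_empty.1 hσ.2
    simpa using hσ.1.card_eq
  rwa [cliqueChains, h, Finsupp.supported_empty, Submodule.mem_bot] at hc

theorem eq_single_of_mem_cliqueChains_zero {S : Finset V} {c : Finset V →₀ F}
    (hc : c ∈ cliqueChains F G S 0) : c = Finsupp.single ∅ (c ∅) := by
  refine Finsupp.support_subset_singleton.1 fun σ hσ => ?_
  obtain ⟨h1, _⟩ := (Finsupp.mem_supported F c).1 hc hσ
  exact Finset.mem_singleton.2 (Finset.card_eq_zero.1 h1.card_eq)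

variable [LinearOrder V]

theorem coneMap_mem_cliqueChains {v : V} {N : Finset V} {m : ℕ} (hN : ∀ w ∈ N, w ≠ v → G.Adj v w)
    {c : Finset V →₀ F} (hc : c ∈ cliqueChains F G N m) :
    coneMap F v c ∈ cliqueChains F G (insert v N) (m + 1) := by
  refine map_mem_cliqueChains _ (fun σ h1 h2 a => ?_) hc
  by_cases hv : v ∈ σ
  · rw [coneMap_single_of_mem hv]
    exact zero_mem _
  · rw [coneMap_single_of_notMem hv]
    refine Finsupp.single_mem_supported F _ ⟨h1.insert fun w hw => hN w (h2 hw) ?_,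
      Finset.insert_subset_insert v h2⟩
    exact fun h => hv (h ▸ hw)

theorem linkMap_mem_cliqueChains {v : V} {S N : Finset V} {m : ℕ}
    (hN : ∀ w ∈ S, G.Adj v w → w ∈ N)
    {c : Finset V →₀ F} (hc : c ∈ cliqueChains F G S (m + 1)) :
    linkMap F v c ∈ cliqueChains F G N m := by
  refine map_mem_cliqueChains _ (fun σ h1 h2 a => ?_) hc
  by_cases hv : v ∈ σ
  · rw [linkMap_single_of_mem hv]
    refine Finsupp.single_mem_supported F _ ⟨h1.erase_of_mem hv, fun w hw => ?_⟩
    obtain ⟨hne, hw⟩ := Finset.mem_erase.1 hw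
    exact hN w (h2 hw) (h1.isClique hv hw hne.symm)
  · rw [linkMap_single_of_notMem hv]
    exact zero_mem _

theorem linkMap_coneMap_mem_cliqueChains (v : V) {S : Finset V} {m : ℕ}
    {c : Finset V →₀ F} (hc : c ∈ cliqueChains F G S m) :
    linkMap F v (coneMap F v c) ∈ cliqueChains F G (S.erase v) m := by
  refine map_mem_cliqueChains (linkMap F v ∘ₗ coneMap F v) (fun σ h1 h2 a => ?_) hc
  rw [LinearMap.comp_apply]
  by_cases hv : v ∈ σ
  · rw [coneMap_single_of_mem hv, map_zero]
    exact zero_mem _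
  · rw [coneMap_single_of_notMem hv, linkMap_single_of_mem (Finset.mem_insert_self v σ),
      Finset.erase_insert hv]
    exact Finsupp.single_mem_supported F _ ⟨h1, Finset.subset_erase.2 ⟨h2, hv⟩⟩

theorem linkMap_eq_zero {v : V} {S : Finset V} {m : ℕ} (hv : v ∉ S)
    {c : Finset V →₀ F} (hc : c ∈ cliqueChains F G S m) : linkMap F v c = 0 := by
  rw [← Finsupp.sum_single c, Finsupp.sum, map_sum]
  refine Finset.sum_eq_zero fun σ hσ => ?_
  obtain ⟨_, h2⟩ := (Finsupp.mem_supported F c).1 hc hσ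
  exact linkMap_single_of_notMem (fun h => hv (h2 h)) _

/-- Every cycle on `m`-vertex simplices of the clique complex of `G` on `S` is a boundary. -/
def CliqueAcyclic (F : Type u) [Field F] {V : Type v} [LinearOrder V] (G : SimpleGraph V)
    (S : Finset V) (m : ℕ) : Prop :=
  ∀ z ∈ cliqueChains F G S m, boundary F V z = 0 →
    ∃ w ∈ cliqueChains F G S (m + 1), boundary F V w = z

theorem CliqueAcyclic.of_cone {S : Finset V} {v : V} (hv : v ∈ S)
    (h : ∀ w ∈ S, w ≠ v → G.Adj v w) (m : ℕ) : CliqueAcyclic F G S m := by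
  intro z hz hz0
  refine ⟨coneMap F v z, ?_, ?_⟩
  · simpa [hv] using coneMap_mem_cliqueChains h hz
  · simpa [hz0] using boundary_coneMap_add v z

/-- This is exactness of deletion, whole complex, link. The link of a cycle `z` is a cycle in `N`,
hence the boundary of some `y`. Adding the boundary of `coneMap F v y` to `z` cancels every simplex
through `v`, and the result is filled inside `S.erase v`. -/
theorem CliqueAcyclic.of_link {S N : Finset V} {v : V} {m : ℕ} (hv : v ∈ S)
    (hN : ∀ w, w ∈ N ↔ w ∈ S ∧ G.Adj v w) (h1 : CliqueAcyclic F G N m)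
    (h2 : CliqueAcyclic F G (S.erase v) (m + 1)) : CliqueAcyclic F G S (m + 1) := by
  intro z hz hz0
  have hNS : N ⊆ S.erase v := fun w hw =>
    Finset.mem_erase.2 ⟨((hN w).1 hw).2.ne', ((hN w).1 hw).1⟩
  obtain ⟨y, hy, hyz⟩ := h1 (linkMap F v z)
    (linkMap_mem_cliqueChains (fun w hw ha => (hN w).2 ⟨hw, ha⟩) hz)
    (by rw [boundary_linkMap, hz0, map_zero, neg_zero])
  have hcy := coneMap_mem_cliqueChains (fun w hw _ => ((hN w).1 hw).2) hy
  have hb := boundary_coneMap_add v y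
  have hd := coneMap_linkMap_add v z
  rw [hyz] at hb
  obtain ⟨w, hw, hwz⟩ := h2 (linkMap F v (coneMap F v z) + y)
    (add_mem (linkMap_coneMap_mem_cliqueChains v hz) (cliqueChains_mono hNS _ hy))
    (by
      have : linkMap F v (coneMap F v z) + y = z + boundary F V (coneMap F v y) := by
        linear_combination (norm := module) hd - hb
      rw [this, map_add, hz0, boundary_boundary, zero_add])
  refine ⟨w - coneMap F v y, sub_mem (cliqueChains_mono (Finset.erase_subset v S) _ hw)
    (cliqueChains_mono (Finset.insert_subset hv (hNS.trans (Finset.erase_subset v S))) _ hcy), ?_⟩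
  rw [map_sub, hwz]
  linear_combination (norm := module) hd - hb

/-- The clique complex of a graph on fewer than `2 m` vertices has no homology on simplices with
`m` vertices. -/
theorem CliqueAcyclic.of_card_lt {S : Finset V} {m : ℕ} (h : S.card < 2 * m) :
    CliqueAcyclic F G S m := by
  classical
  induction hs : S.card using Nat.strong_induction_on generalizing S m with
  | _ s ih =>
  subst hs
  obtain _ | m := m
  · omega
  obtain rfl | ⟨v, hv⟩ := S.eq_empty_or_nonempty
  · intro z hz _
    exact ⟨0, zero_mem _, by rw [map_zero, eq_zero_of_mem_cliqueChains_empty hz]⟩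
  by_cases hc : ∀ w ∈ S, w ≠ v → G.Adj v w
  · exact .of_cone hv hc _
  push Not at hc
  obtain ⟨w, hw, hwv, ha⟩ := hc
  -- The link loses at least two vertices while the face size drops by one; the deletion loses one
  -- vertex at the same face size.
  have hsub : S.filter (G.Adj v) ⊆ (S.erase v).erase w := fun u hu => by
    obtain ⟨huS, hu⟩ := Finset.mem_filter.1 hu
    exact Finset.mem_erase.2 ⟨fun h => ha (h ▸ hu), Finset.mem_erase.2 ⟨hu.ne', huS⟩⟩
  have h1 := Finset.card_le_card hsub
  have h2 := Finset.card_erase_add_one (Finset.mem_erase.2 ⟨hwv, hw⟩)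
  have h3 := Finset.card_erase_add_one hv
  exact .of_link hv (fun u => Finset.mem_filter) (ih _ (by omega) (by omega) rfl)
    (ih _ (by omega) (by omega) rfl)

/-- The graph induced by `G` on `S` is the 1-skeleton of a cross-polytope: every vertex has exactly
one non-neighbour other than itself. -/
def IsCrossPolytope (G : SimpleGraph V) (S : Finset V) : Prop :=
  ∀ v ∈ S, ∃! w, w ∈ S ∧ w ≠ v ∧ ¬G.Adj v w

/-- A vertex with no non-neighbour is a cone point. With two non-neighbours its link has at most `2
* m - 3` vertices, and its deletion has `2 * m - 1`, so both fall under the strict bound. -/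
theorem isCrossPolytope_of_not_cliqueAcyclic {S : Finset V} {m : ℕ} (hS : S.card = 2 * m)
    (h : ¬CliqueAcyclic F G S m) : IsCrossPolytope G S := by
  classical
  intro v hv
  obtain ⟨w, hw, hwv, ha⟩ : ∃ w ∈ S, w ≠ v ∧ ¬G.Adj v w := by
    by_contra! hc
    exact h (.of_cone hv hc m)
  refine ⟨w, ⟨hw, hwv, ha⟩, ?_⟩
  rintro u ⟨hu, huv, hau⟩
  by_contra hne
  obtain _ | m := m
  · simp_all
  have hsub : S.filter (G.Adj v) ⊆ ((S.erase v).erase w).erase u := fun x hx => by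
    obtain ⟨hxS, hx⟩ := Finset.mem_filter.1 hx
    exact Finset.mem_erase.2 ⟨fun h => hau (h ▸ hx), Finset.mem_erase.2
      ⟨fun h => ha (h ▸ hx), Finset.mem_erase.2 ⟨hx.ne', hxS⟩⟩⟩
  have h1 := Finset.card_le_card hsub
  have h0 := Finset.card_erase_add_one
    (Finset.mem_erase.2 ⟨hne, Finset.mem_erase.2 ⟨huv, hu⟩⟩)
  have h2 := Finset.card_erase_add_one (Finset.mem_erase.2 ⟨hwv, hw⟩)
  have h3 := Finset.card_erase_add_one hv
  exact h (.of_link hv (fun u => Finset.mem_filter) (.of_card_lt (by omega))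
    (.of_card_lt (by omega)))

/-- The class of the cycle `g` is a basis of the homology on `m`-vertex simplices of the clique
complex of `G` on `S`. -/
structure IsFundamentalCycle (G : SimpleGraph V) (S : Finset V) (m : ℕ) (g : Finset V →₀ F) :
    Prop where
  mem : g ∈ cliqueChains F G S m
  boundary_eq_zero : boundary F V g = 0
  boundary_ne : ∀ w ∈ cliqueChains F G S (m + 1), boundary F V w ≠ g
  exists_eq : ∀ z ∈ cliqueChains F G S m, boundary F V z = 0 →
    ∃ a : F, ∃ w ∈ cliqueChains F G S (m + 1), z = a • g + boundary F V w

/-- The empty complex is the sphere of dimension `-1`: the empty face spans its reduced homology. -/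
theorem isFundamentalCycle_empty :
    IsFundamentalCycle G (∅ : Finset V) 0 (Finsupp.single ∅ (1 : F)) where
  mem := Finsupp.single_mem_supported F _ ⟨by simp [SimpleGraph.isNClique_iff], subset_rfl⟩
  boundary_eq_zero := by simp [boundary_single']
  boundary_ne w hw := by
    rw [eq_zero_of_mem_cliqueChains_empty hw, map_zero]
    exact (Finsupp.single_ne_zero.2 one_ne_zero).symm
  exists_eq z hz _ := ⟨z ∅, 0, zero_mem _, by
    rw [map_zero, add_zero, Finsupp.smul_single, smul_eq_mul, mul_one]
    exact eq_single_of_mem_cliqueChains_zero hz⟩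

/-- The suspension of a fundamental cycle is a fundamental cycle. -/
theorem IsFundamentalCycle.suspend {S N : Finset V} {m : ℕ} {v v' : V} {g : Finset V →₀ F}
    (hg : IsFundamentalCycle G N m g) (hv : v ∈ S) (hv' : v' ∈ S) (hne : v' ≠ v)
    (hN : ∀ w, w ∈ N ↔ w ∈ S ∧ G.Adj v w) (hN' : ∀ w ∈ N, G.Adj v' w)
    (hacyc : CliqueAcyclic F G (S.erase v) (m + 1)) :
    IsFundamentalCycle G S (m + 1) (coneMap F v g - coneMap F v' g) := by
  have hNS : N ⊆ S.erase v := fun w hw =>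
    Finset.mem_erase.2 ⟨((hN w).1 hw).2.ne', ((hN w).1 hw).1⟩
  have hv'N : insert v' N ⊆ S.erase v :=
    Finset.insert_subset (Finset.mem_erase.2 ⟨hne, hv'⟩) hNS
  have hSS := Finset.erase_subset v S
  have hvN : insert v N ⊆ S := Finset.insert_subset hv (hNS.trans hSS)
  have hcone : ∀ {n : ℕ} {y : Finset V →₀ F}, y ∈ cliqueChains F G N n →
      coneMap F v y ∈ cliqueChains F G S (n + 1) := fun hy =>
    cliqueChains_mono hvN _ (coneMap_mem_cliqueChains (fun w hw _ => ((hN w).1 hw).2) hy)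
  have hlink : ∀ {n : ℕ} {z : Finset V →₀ F}, z ∈ cliqueChains F G S (n + 1) →
      linkMap F v z ∈ cliqueChains F G N n := fun hz =>
    linkMap_mem_cliqueChains (fun w hw ha => (hN w).2 ⟨hw, ha⟩) hz
  have hcone' : coneMap F v' g ∈ cliqueChains F G (S.erase v) (m + 1) :=
    cliqueChains_mono hv'N _ (coneMap_mem_cliqueChains (fun w hw _ => hN' w hw) hg.mem)
  have hb := boundary_coneMap_add v g
  have hb' := boundary_coneMap_add v' g
  rw [hg.boundary_eq_zero, map_zero, add_zero] at hb hb'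
  have hcycle : boundary F V (coneMap F v g - coneMap F v' g) = 0 := by
    rw [map_sub, hb, hb', sub_self]
  have hlg : linkMap F v (coneMap F v g - coneMap F v' g) = g := by
    have h := coneMap_linkMap_add v g
    rw [linkMap_eq_zero (fun h => (Finset.mem_erase.1 (hNS h)).1 rfl) hg.mem, map_zero,
      zero_add] at h
    rw [map_sub, h, linkMap_eq_zero (Finset.notMem_erase v S) hcone', sub_zero]
  refine ⟨sub_mem (hcone hg.mem) (cliqueChains_mono hSS _ hcone'), hcycle, ?_, ?_⟩
  -- Contraction with `v` turns a filling of the suspension into a filling of `g`, up to sign.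
  · intro w hw hwg
    refine hg.boundary_ne (-linkMap F v w) (neg_mem (hlink hw)) ?_
    rw [map_neg, boundary_linkMap, neg_neg, hwg, hlg]
  · intro z hz hz0
    obtain ⟨a, y, hy, hzy⟩ := hg.exists_eq (linkMap F v z) (hlink hz)
      (by rw [boundary_linkMap, hz0, map_zero, neg_zero])
    have hby := boundary_coneMap_add v y
    have hd := coneMap_linkMap_add v z
    have hcz : coneMap F v (linkMap F v z) = a • coneMap F v g + coneMap F v (boundary F V y) := by
      rw [hzy, map_add, map_smul]
    -- The left side avoids `v`; the right side is a cycle differing from `z` by a multiple of the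
    -- suspension and a boundary. So `hacyc` fills it.
    have heq : linkMap F v (coneMap F v z) + y + a • coneMap F v' g =
        z - a • (coneMap F v g - coneMap F v' g) + boundary F V (coneMap F v y) := by
      linear_combination (norm := module) hd - hby - hcz
    obtain ⟨w, hw, hwz⟩ := hacyc (linkMap F v (coneMap F v z) + y + a • coneMap F v' g)
      (add_mem (add_mem (linkMap_coneMap_mem_cliqueChains v hz) (cliqueChains_mono hNS _ hy))
        (Submodule.smul_mem _ _ hcone'))
      (by rw [heq, map_add, map_sub, map_smul, hz0, hcycle, boundary_boundary, smul_zero, sub_zero,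
        add_zero])
    refine ⟨a, w - coneMap F v y, sub_mem (cliqueChains_mono hSS _ hw) (hcone hy), ?_⟩
    rw [map_sub, hwz, heq]
    module

/-- Removing an antipodal pair `v`, `v'` leaves a smaller cross-polytope, which is the link of both,
so the complex on `S` is its suspension. -/
theorem IsCrossPolytope.exists_isFundamentalCycle {S : Finset V} {m : ℕ}
    (h : IsCrossPolytope G S) (hS : S.card = 2 * m) :
    ∃ g : Finset V →₀ F, IsFundamentalCycle G S m g := by
  classical
  induction m generalizing S with
  | zero =>
    obtain rfl := Finset.card_eq_zero.1 hS
    exact ⟨_, isFundamentalCycle_empty⟩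
  | succ m ih =>
    obtain ⟨v, hv⟩ : S.Nonempty := Finset.card_pos.1 (by omega)
    obtain ⟨v', ⟨hv', hne, ha⟩, huniq⟩ := h v hv
    have hadj : ∀ w ∈ S, w ≠ v → w ≠ v' → G.Adj v w := fun w hw h1 h2 => by
      by_contra h3
      exact h2 (huniq w ⟨hw, h1, h3⟩)
    have hadj' : ∀ w ∈ S, w ≠ v → w ≠ v' → G.Adj v' w := fun w hw h1 h2 => by
      by_contra h3
      exact h1 ((h v' hv').unique ⟨hw, h2, h3⟩ ⟨hv, hne.symm, fun h => ha h.symm⟩)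
    have hN : ∀ w, w ∈ (S.erase v).erase v' ↔ w ∈ S ∧ G.Adj v w := fun w => by
      simp only [Finset.mem_erase]
      exact ⟨fun hw => ⟨hw.2.2, hadj w hw.2.2 hw.2.1 hw.1⟩,
        fun hw => ⟨fun h => ha (h ▸ hw.2), hw.2.ne', hw.1⟩⟩
    have h2 := Finset.card_erase_add_one (Finset.mem_erase.2 ⟨hne, hv'⟩)
    have h3 := Finset.card_erase_add_one hv
    have hcross : IsCrossPolytope G ((S.erase v).erase v') := fun u hu => by
      simp only [Finset.mem_erase] at hu
      obtain ⟨u', ⟨hu', hne', ha'⟩, huniq'⟩ := h u hu.2.2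
      refine ⟨u', ⟨?_, hne', ha'⟩, fun w hw => huniq' w ⟨?_, hw.2⟩⟩
      -- The antipode of `u` is neither `v` nor `v'`, since `u` is adjacent to both.
      · simp only [Finset.mem_erase]
        refine ⟨?_, ?_, hu'⟩
        · rintro rfl
          exact ha' (hadj' u hu.2.2 hu.2.1 hu.1).symm
        · rintro rfl
          exact ha' (hadj u hu.2.2 hu.2.1 hu.1).symm
      · exact Finset.mem_of_mem_erase (Finset.mem_of_mem_erase hw.1)
    obtain ⟨g, hg⟩ := ih hcross (by omega)
    refine ⟨_, hg.suspend hv hv' hne hN (fun w hw => ?_) (.of_card_lt (by omega))⟩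
    simp only [Finset.mem_erase] at hw
    exact hadj' w hw.2.2 hw.2.1 hw.1

end Clique

/-! ### Recognising interval modules. -/

section Interval

variable {F : Type u} [Field F]

theorem subsingleton_intervalValue {b d : ℝ} {r : ℝ≥0} (h : ¬(b ≤ r ∧ r < d)) :
    Subsingleton (intervalValue F b d r) := by
  rw [intervalValue, if_neg h]
  infer_instance

theorem coe_intervalMap {b d : ℝ} {r s : ℝ≥0} (hr : b ≤ r ∧ r < d) (hs : b ≤ s ∧ s < d)
    (x : intervalValue F b d r) : (intervalMap F b d r s x : F) = x := by
  rw [intervalMap, dif_pos ⟨hr, hs⟩]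
  rfl

/-- A persistence module is the interval module `I[b, d)` if it vanishes outside of `[b, d)` and
if a single vector at the scale `b` restricts to a basis at each scale in `[b, d)`. -/
theorem isInterval_of_generator (M : ℝ≥0 ⥤ ModuleCat.{max u v} F) (b : ℝ≥0) {d : ℝ} (hbd : b < d)
    (g : M.obj b) (hout : ∀ r : ℝ≥0, ¬((b : ℝ) ≤ r ∧ r < d) → Subsingleton (M.obj r))
    (hin : ∀ (r : ℝ≥0) (hr : b ≤ r), r < d →
      Function.Bijective (fun a : F => a • (M.map (homOfLE hr)).hom g)) :
    IsInterval.{u, v} M b d := by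
  classical
  refine ⟨hbd, ⟨Iso.symm ?_⟩⟩
  -- The transported generator; the default `0` is harmless because the interval module vanishes
  -- below `b`.
  let sec (r : ℝ≥0) : M.obj r := if hr : b ≤ r then (M.map (homOfLE hr)).hom g else 0
  let φ (r : ℝ≥0) : ULift.{v} (intervalValue F b d r) →ₗ[F] M.obj r :=
    LinearMap.toSpanSingleton F _ (sec r) ∘ₗ (intervalValue F b d r).subtype ∘ₗ
      ULift.moduleEquiv.toLinearMap
  have hφ (r : ℝ≥0) (x : ULift.{v} (intervalValue F b d r)) : φ r x = (x.down : F) • sec r := rfl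
  have hsec (r : ℝ≥0) (hr : b ≤ r) : sec r = (M.map (homOfLE hr)).hom g := dif_pos hr
  have hbij (r : ℝ≥0) : Function.Bijective (φ r) := by
    by_cases h : (b : ℝ) ≤ r ∧ r < d
    · have hb := hin r (NNReal.coe_le_coe.1 h.1) h.2
      refine ⟨fun x y hxy => ?_, fun y => ?_⟩
      · rw [hφ, hφ, hsec r (NNReal.coe_le_coe.1 h.1)] at hxy
        exact ULift.ext _ _ (Subtype.ext (hb.1 hxy))
      · obtain ⟨a, rfl⟩ := hb.2 y
        refine ⟨⟨a, by simp [intervalValue, h]⟩, ?_⟩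
        rw [hφ, hsec r (NNReal.coe_le_coe.1 h.1)]
    · have h1 := subsingleton_intervalValue (F := F) h
      have h2 := hout r h
      exact ⟨fun x y _ => Subsingleton.elim _ _, fun y => ⟨0, Subsingleton.elim _ _⟩⟩
  refine NatIso.ofComponents (fun r => (LinearEquiv.ofBijective (φ r) (hbij r)).toModuleIso) ?_
  intro r s f
  refine ModuleCat.hom_ext (LinearMap.ext fun x => ?_)
  change ULift.{v} (intervalValue F b d r) at x
  change φ s ⟨intervalMap F b d r s x.down⟩ = (M.map f).hom (φ r x)
  by_cases hs : (b : ℝ) ≤ s ∧ s < d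
  · by_cases hr : (b : ℝ) ≤ r ∧ r < d
    · rw [hφ, hφ, map_smul, coe_intervalMap hr hs, hsec r (NNReal.coe_le_coe.1 hr.1),
        hsec s (NNReal.coe_le_coe.1 hs.1), ← LinearMap.comp_apply, ← ModuleCat.hom_comp,
        ← M.map_comp]
      rfl
    · have h1 := subsingleton_intervalValue (F := F) hr
      rw [Subsingleton.elim x 0]
      simp [hφ]
  · have h2 := hout s hs
    exact Subsingleton.elim _ _

end Interval

/-! ### Vietoris-Rips complexes as clique complexes. -/

section VietorisRips

variable {F : Type u} [Field F] {X : Type v} [MetricSpace X]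

/-- The graph joining distinct points at distance at most `r`. -/
def neighborGraph (X : Type v) [MetricSpace X] (r : ℝ≥0) : SimpleGraph X where
  Adj x y := x ≠ y ∧ dist x y ≤ r
  symm := ⟨fun x y h => ⟨h.1.symm, dist_comm x y ▸ h.2⟩⟩
  loopless := ⟨fun _ h => h.1 rfl⟩

theorem isClique_neighborGraph_iff {r : ℝ≥0} {σ : Finset X} :
    (neighborGraph X r).IsClique (σ : Set X) ↔ Metric.diam (σ : Set X) ≤ r := by
  refine ⟨fun h => Metric.diam_le_of_forall_dist_le r.2 fun x hx y hy => ?_,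
    fun h x hx y hy hne => ⟨hne, ?_⟩⟩
  · obtain rfl | hne := eq_or_ne x y
    · simp
    · exact (h hx hy hne).2
  · exact (Metric.dist_le_diam_of_mem (Finset.finite_toSet σ).isBounded hx hy).trans h

/-- A diameter bound is a condition on pairs. The empty face, added by hand in `chains`, is the
empty clique. -/
theorem chains_vrComplex [Fintype X] (r : ℝ≥0) {k : ℤ} {m : ℕ} (hk : k + 1 = m) :
    chains F (vrComplex X r) k = cliqueChains F (neighborGraph X r) Finset.univ m := by
  rw [chains, cliqueChains]
  congr 1
  ext σ
  simp only [Set.mem_ofPred_eq, hk, Nat.cast_inj, SimpleGraph.isNClique_iff, Finset.subset_univ,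
    and_true, isClique_neighborGraph_iff]
  refine and_congr_left fun _ => ⟨?_, fun h => ?_⟩
  · rintro (rfl | h)
    · simp
    · exact h.2
  · exact σ.eq_empty_or_nonempty.imp_right fun hσ => ⟨hσ, h⟩

theorem chains_vrComplex_succ [Fintype X] (r : ℝ≥0) {k : ℤ} {m : ℕ} (hk : k + 1 = m) :
    chains F (vrComplex X r) (k + 1) = cliqueChains F (neighborGraph X r) Finset.univ (m + 1) :=
  chains_vrComplex r (by push_cast; omega)

variable [LinearOrder X] [Fintype X] {r : ℝ≥0} {k : ℤ} {m : ℕ}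

theorem mem_cycles_vrComplex (hk : k + 1 = m) {z : Finset X →₀ F} :
    z ∈ cycles F (vrComplex X r) k ↔
      z ∈ cliqueChains F (neighborGraph X r) Finset.univ m ∧ boundary F X z = 0 := by
  rw [cycles, chains_vrComplex r hk]
  rfl

theorem mem_boundaries_vrComplex (hk : k + 1 = m) {z : Finset X →₀ F} :
    z ∈ boundaries F (vrComplex X r) k ↔
      ∃ w ∈ cliqueChains F (neighborGraph X r) Finset.univ (m + 1), boundary F X w = z := by
  rw [boundaries, chains_vrComplex_succ r hk]
  rfl

theorem CliqueAcyclic.subsingleton_reducedHomology (hk : k + 1 = m)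
    (h : CliqueAcyclic F (neighborGraph X r) Finset.univ m) :
    Subsingleton (ReducedHomology F (vrComplex X r) k) := by
  refine Submodule.Quotient.subsingleton_iff.2 (Submodule.eq_top_iff'.2 ?_)
  rintro ⟨z, hz⟩
  rw [mem_cycles_vrComplex hk] at hz
  exact (mem_boundaries_vrComplex hk).2 (h z hz.1 hz.2)

theorem IsFundamentalCycle.bijective_smul_mk (hk : k + 1 = m) {g : Finset X →₀ F}
    (h : IsFundamentalCycle (neighborGraph X r) Finset.univ m g)
    (hg : g ∈ cycles F (vrComplex X r) k) :
    Function.Bijective (fun a : F => a •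
      (Submodule.Quotient.mk ⟨g, hg⟩ : ReducedHomology F (vrComplex X r) k)) := by
  constructor
  · refine smul_left_injective F fun h0 => ?_
    rw [Submodule.Quotient.mk_eq_zero] at h0
    obtain ⟨w, hw, hwg⟩ := (mem_boundaries_vrComplex hk).1 h0
    exact h.boundary_ne w hw hwg
  · intro y
    obtain ⟨⟨z, hz⟩, rfl⟩ := Submodule.Quotient.mk_surjective _ y
    have hz' := (mem_cycles_vrComplex hk).1 hz
    obtain ⟨a, w, hw, hzw⟩ := h.exists_eq z hz'.1 hz'.2
    refine ⟨a, ?_⟩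
    dsimp only
    rw [← Submodule.Quotient.mk_smul]
    refine ((Submodule.Quotient.eq _).2 ?_).symm
    refine (mem_boundaries_vrComplex hk).2 ⟨w, hw, ?_⟩
    rw [eq_comm]
    simp [hzw]

theorem isZero_orderedPersistentHomology (hk : k + 1 = m)
    (h : ∀ r, CliqueAcyclic F (neighborGraph X r) Finset.univ m) :
    IsZero (orderedPersistentHomology F X k) :=
  Functor.isZero _ fun r =>
    haveI := (h r).subsingleton_reducedHomology hk
    ModuleCat.isZero_of_subsingleton (ModuleCat.of F (ReducedHomology F (vrComplex X r) k))

end VietorisRips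

/-! ### Scales at which the graph is a cross-polytope. -/

section BirthDeath

variable {X : Type v} [MetricSpace X]

theorem birth_nonneg : 0 ≤ birth X := Real.iSup_nonneg fun _ => dist_nonneg

variable [Finite X]

theorem birth_le_iff [Nonempty X] {r : ℝ} : birth X ≤ r ↔ ∀ x : X, pointBirth x ≤ r :=
  ciSup_le_iff (Set.finite_range _).bddAbove

theorem lt_death_iff [Nonempty X] {r : ℝ} : r < death X ↔ ∀ x : X, r < pointDeath x :=
  ⟨fun h x => h.trans_le (ciInf_le (Set.finite_range _).bddBelow x), fun h => by
    obtain ⟨x, hx⟩ := exists_eq_ciInf_of_finite (f := fun x : X => pointDeath x)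
    exact (h x).trans_eq hx⟩

/-- A point at distance more than `t_b(x)` from `x` is the farthest one. -/
theorem eq_twoFarthest_fst [Nontrivial X] {x y : X} (h : pointBirth x < dist x y) :
    y = (twoFarthest x).1 := by
  obtain ⟨_, _, hmax⟩ := twoFarthest_spec x
  by_contra hne
  by_cases h2 : y = (twoFarthest x).2
  · exact h.ne (by rw [h2]; rfl)
  · exact h.not_ge (hmax y hne h2)

theorem dist_le_pointDeath [Nontrivial X] (x y : X) : dist x y ≤ pointDeath x := by
  obtain ⟨_, hle, hmax⟩ := twoFarthest_spec x
  by_cases h1 : y = (twoFarthest x).1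
  · rw [h1]; rfl
  by_cases h2 : y = (twoFarthest x).2
  · rw [h2]; exact hle
  exact (hmax y h1 h2).trans hle

/-- The Vietoris-Rips complex at scale `r` is a cross-polytope iff `t_b(X) ≤ r < t_d(X)`. -/
theorem isCrossPolytope_neighborGraph_iff [Fintype X] [Nontrivial X] {r : ℝ≥0} :
    IsCrossPolytope (neighborGraph X r) Finset.univ ↔ birth X ≤ r ∧ r < death X := by
  rw [birth_le_iff, lt_death_iff, ← forall_and]
  simp only [IsCrossPolytope, Finset.mem_univ, true_and, forall_true_left]
  refine forall_congr' fun x => ⟨?_, ?_⟩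
  · rintro ⟨y, ⟨hyx, hy⟩, huniq⟩
    have hlt : ∀ z, z ≠ x → ¬(neighborGraph X r).Adj x z → r < dist x z := fun z hzx hz =>
      not_le.1 fun h => hz ⟨hzx.symm, h⟩
    have hdeath := (hlt y hyx hy).trans_le (dist_le_pointDeath x y)
    refine ⟨not_lt.1 fun hb => (twoFarthest_spec x).1 ?_, hdeath⟩
    -- If `r < pointBirth x`, both farthest points would be the unique non-neighbour of `x`,
    -- although they are distinct.
    have key : ∀ z, (r : ℝ) < dist x z → z = y := fun z hz =>
      huniq z ⟨by rintro rfl; exact hz.not_ge (by simp), fun h => hz.not_ge h.2⟩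
    rw [key _ hb, key _ hdeath]
  · rintro ⟨hb, hd⟩
    refine ⟨(twoFarthest x).1, ⟨fun h => ?_, fun h => hd.not_ge h.2⟩, fun z hz => ?_⟩
    · rw [pointDeath, h, dist_self] at hd
      exact hd.not_ge r.2
    · exact eq_twoFarthest_fst (hb.trans_lt (not_le.1 fun h => hz.2 ⟨hz.1.symm, h⟩))

/-- The Vietoris-Rips graph does not change at the scales in `[t_b(X), t_d(X))`. -/
theorem neighborGraph_eq_of_le [Nontrivial X] {b r : ℝ≥0} (hb : birth X ≤ b) (hbr : b ≤ r)
    (hr : r < death X) : neighborGraph X r = neighborGraph X b := by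
  ext x y
  refine and_congr_right fun _ => ⟨fun h => not_lt.1 fun hlt => ?_,
    fun h => h.trans (NNReal.coe_le_coe.2 hbr)⟩
  -- An edge longer than `b` would end at the farthest point from `x`, whose distance exceeds `r`.
  have hy := eq_twoFarthest_fst ((birth_le_iff.1 hb x).trans_lt hlt)
  refine (lt_death_iff.1 hr x).not_ge ?_
  rw [hy] at h
  exact h

variable {F : Type u} [Field F] [LinearOrder X] [Fintype X]

theorem isInterval_orderedPersistentHomology [Nontrivial X] {k : ℤ} {m : ℕ} (hk : k + 1 = m)
    (hm : Fintype.card X = 2 * m) (h : birth X < death X) :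
    IsInterval.{u, v} (orderedPersistentHomology F X k) (birth X) (death X) := by
  have hm' : (Finset.univ : Finset X).card = 2 * m := hm
  obtain ⟨b, hb⟩ : ∃ b : ℝ≥0, (b : ℝ) = birth X := ⟨⟨_, birth_nonneg⟩, rfl⟩
  have hbd : b < death X := hb ▸ h
  obtain ⟨g, hg⟩ := (isCrossPolytope_neighborGraph_iff.2 ⟨hb.ge, hbd⟩).exists_isFundamentalCycle
    (F := F) hm'
  have hgz : g ∈ cycles F (vrComplex X b) k :=
    (mem_cycles_vrComplex hk).2 ⟨hg.mem, hg.boundary_eq_zero⟩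
  rw [← hb]
  refine isInterval_of_generator _ b hbd
    (Submodule.Quotient.mk ⟨g, hgz⟩ : ReducedHomology F (vrComplex X b) k) ?_ ?_
  · intro r hr
    refine CliqueAcyclic.subsingleton_reducedHomology hk ?_
    by_contra hc
    exact hr (hb ▸ isCrossPolytope_neighborGraph_iff.1
      (isCrossPolytope_of_not_cliqueAcyclic hm' hc))
  · intro r hr hrd
    -- The graph at `r` equals the one at `b`, and the structure map keeps the representing chain
    -- `g`.
    exact IsFundamentalCycle.bijective_smul_mk hk
      (neighborGraph_eq_of_le hb.ge hr hrd ▸ hg) (cycles_mono F (vrComplex_mono X hr) k hgz)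

end BirthDeath

end VR

/-! ### Degrees above and equal to `n / 2 - 1`. -/

theorem theorem4p4 {F : Type*} [Field F] {X : Type*} [MetricSpace X] [Finite X] [Nonempty X]
    (n : ℕ) (hn : Nat.card X = n) :
    (∀ k : ℤ, (n : ℝ) / 2 - 1 < k → IsZero (VR.persistentHomology F X k)) ∧
    (Even n → ∀ k : ℤ, (k : ℝ) = (n : ℝ) / 2 - 1 →
      (VR.IsInterval (VR.persistentHomology F X k) (VR.birth X) (VR.death X) ↔
        VR.birth X < VR.death X) ∧
      (¬ VR.birth X < VR.death X → IsZero (VR.persistentHomology F X k))) := by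
  -- With this order, `VR.persistentHomology` is by definition `VR.orderedPersistentHomology`.
  let _ : LinearOrder X := VR.vertexOrder X
  let _ : Fintype X := Fintype.ofFinite X
  have hcard : (Finset.univ : Finset X).card = n := by
    rw [← hn, Nat.card_eq_fintype_card, Finset.card_univ]
  constructor
  · intro k hk
    have hk' : (n : ℤ) < 2 * (k + 1) := by
      have : (n : ℝ) < 2 * (k + 1) := by linarith
      exact_mod_cast this
    obtain ⟨m, hm⟩ := Int.eq_ofNat_of_zero_le (show 0 ≤ k + 1 by omega)
    exact VR.isZero_orderedPersistentHomology hm fun r => .of_card_lt (by omega)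
  · intro heven k hk
    have hk' : 2 * (k + 1) = (n : ℤ) := by
      have : 2 * ((k : ℝ) + 1) = n := by linarith
      exact_mod_cast this
    obtain ⟨m, hm⟩ := Int.eq_ofNat_of_zero_le (show 0 ≤ k + 1 by omega)
    have hnm : (Finset.univ : Finset X).card = 2 * m := by omega
    have hpos : 0 < (Finset.univ : Finset X).card := Finset.card_pos.2 Finset.univ_nonempty
    -- A positive even number of points is at least two, so two farthest points exist.
    have : Nontrivial X := Fintype.one_lt_card_iff_nontrivial.1 (by rw [← Finset.card_univ]; omega)
    refine ⟨⟨fun h => h.1, VR.isInterval_orderedPersistentHomology hm hnm⟩, fun h => ?_⟩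
    refine VR.isZero_orderedPersistentHomology hm fun r => ?_
    by_contra hc
    have := VR.isCrossPolytope_neighborGraph_iff.1
      (VR.isCrossPolytope_of_not_cliqueAcyclic hnm hc)
    exact h (this.1.trans_lt this.2)
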